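/- Let $q\geq 3$ and $k\geq 2$ be integers. An instance $I$ of $\mathsf{k\,CSP\!-\!q}$ consists of $n$ variables with values in $\Sigma_q=\{0,\ldots,q-1\}$ and an objective function $v(I,x)=\sum_{i=1}^m w_i P_i(x_{J_i})$, $x\in\Sigma_q^n$, to be either maximized or minimized, where for each $i$ the support $J_i$ is a subsequence of $(1,\ldots,n)$ of length $k_i\leq k$, $P_i:\Sigma_q^{k_i}\to\mathbb{R}$, and $w_i>0$. Let $\mathrm{opt}(I)$ and $\mathrm{wor}(I)$ be the best and the worst solution values of $I$. The strong chromatic number $\nu$ of $I$ is the smallest integer such that $[n]$ can be partitioned into $\nu$ classes, each containing at most one index of every support $J_i$. If $\mathrm{opt}(I)\neq\mathrm{wor}(I)$, the average differential ratio on $I$ is $$\mathrm{avd}(I)=\frac{\mathbb{E}_X[v(I,X)]-\mathrm{wor}(I)}{\mathrm{opt}(I)-\mathrm{wor}(I)},$$ where $X$ is uniformly distributed over $\Sigma_q^n$. Let $p^\kappa$ be the smallest prime power with $p^\kappa\geq q$; thus $p^\kappa=q$ if $q$ is a prime power, and $p^\kappa\leq 2(q-1)$ otherwise. Then for every instance $I$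 of $\mathsf{k\,CSP\!-\!q}$ with $\mathrm{opt}(I)\neq\mathrm{wor}(I)$ and strong chromatic number $\nu\geq k$, $$\mathrm{avd}(I)\;\geq\;\frac{1}{p^\kappa}\cdot\frac{1}{p^{\kappa\lceil\log_{p^\kappa}\nu\rceil\left(k-\lceil\log_{p^\kappa}k\rceil\right)}}\;\geq\;\frac{1}{p^\kappa}\cdot\frac{1}{(p^\kappa\nu)^{k-\lceil\log_{p^\kappa}k\rceil}}.$$ In particular, there is a constant $C>0$ depending only on $q$ and $k$ such that $\mathrm{avd}(I)\geq C/n^{k-\lceil\log_{p^\kappa}k\rceil}$ for all such instances $I$ on $n$ variables. -/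

import Mathlib

/-- Whether the objective of an optimization CSP is to be maximized or minimized. -/
inductive CSPGoal where
  | maximize
  | minimize

/-- An instance of the optimization problem `CSP-q`: variables `x_0, …, x_{n-1}` with values in
the alphabet `{0, …, q-1}`, and `m` constraints. The `i`-th constraint applies a real-valued
function `P i` of `arity i` arguments to a subsequence `support i` of the variables, and carries a
positive weight `w i`. -/
structure CSPInstance (q : ℕ) where
  /-- number of variables -/
  n : ℕ
  /-- number of constraints -/
  m : ℕ
  /-- number of variables occurring in each constraint -/
  arity : Fin m → ℕ
  /-- the (strictly increasing) sequence of variable indices of each constraint -/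
  support : (i : Fin m) → Fin (arity i) ↪o Fin n
  /-- the function applied by each constraint -/
  P : (i : Fin m) → (Fin (arity i) → Fin q) → ℝ
  /-- the weight of each constraint -/
  w : Fin m → ℝ
  w_pos : ∀ i, 0 < w i
  /-- the optimization goal -/
  goal : CSPGoal

namespace CSPInstance

variable {q : ℕ}

/-- `I` is an instance of `k CSP-q`: every constraint depends on at most `k` variables. -/
def IsKCSP (I : CSPInstance q) (k : ℕ) : Prop := ∀ i, I.arity i ≤ k

/-- The objective value `v(I, x) = ∑ i, w i * P i (x restricted to the support of i)`. -/
noncomputable def value (I : CSPInstance q) (x : Fin I.n → Fin q) : ℝ :=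
  ∑ i, I.w i * I.P i (fun j => x (I.support i j))

/-- The best solution value. -/
noncomputable def opt (I : CSPInstance q) : ℝ :=
  match I.goal with
  | .maximize => ⨆ x, I.value x
  | .minimize => ⨅ x, I.value x

/-- The worst solution value. -/
noncomputable def wor (I : CSPInstance q) : ℝ :=
  match I.goal with
  | .maximize => ⨅ x, I.value x
  | .minimize => ⨆ x, I.value x

/-- The expected value of a uniformly random solution. -/
noncomputable def avg (I : CSPInstance q) : ℝ :=
  (∑ x, I.value x) / (q : ℝ) ^ I.n

/-- The average differential ratio; it is meaningful when `I.opt ≠ I.wor`. -/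
noncomputable def avgDifferentialRatio (I : CSPInstance q) : ℝ :=
  (I.avg - I.wor) / (I.opt - I.wor)

/-- `I` is `c`-partite: the variable indices can be coloured with `c` colours so that the support
of each constraint meets each colour class in at most one index. -/
def IsPartite (I : CSPInstance q) (c : ℕ) : Prop :=
  ∃ col : Fin I.n → Fin c, ∀ i, Function.Injective (fun j => col (I.support i j))

theorem isPartite_n (I : CSPInstance q) : I.IsPartite I.n :=
  ⟨id, fun i => (I.support i).injective⟩

/-- The strong chromatic number: the smallest `c` such that `I` is `c`-partite. -/
noncomputable def strongChromaticNumber (I : CSPInstance q) : ℕ :=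
  sInf {c | I.IsPartite c}

end CSPInstance

/-!
The proof exhibits, around an optimal solution `x`, a random solution `Y` that equals `x` with
probability at least `1 / R`, where `R = Q ^ (1 + t * (k - ⌈log_Q k⌉))` and `t = ⌈log_Q ν⌉`, and
whose restriction to the support of every constraint is uniform. Each constraint then has the same
expectation under `Y` as under a uniform solution, so the average value of the instance is the
expectation of `v(I, Y)`, which is at least `opt / R + (1 - 1 / R) * wor` for a maximization
problem. This gives `avd ≥ 1 / R`.

The correlations of `Y` come from a linear orthogonal array of strength `k` with `R` rows over the
field `K` with `Q` elements, as in the theory of BCH codes. Its columns are indexed by the extension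
field `F` of degree `t`, to a point `x` of which one attaches the vector
`(1, (x ^ i)_i) ∈ K × (E → F)`, with `i` running over the set `E` of the numbers in `[1, k)` that are
not one of `Q, Q ^ 2, …`. The rows are the `K`-linear functionals on `K × (E → F)`. Any `k` of
the vectors are linearly independent over `K` (`linearIndependent_bchVector`): as `c ^ Q = c` on `K`,
a relation `∑ c_s x_s = 0` can be raised to the power `Q ^ j`, which restores the missing exponents,
and Vandermonde's determinant applies.

The alphabet is cut down from `Q` to `q` letters by independent noise (`noiseKernel`): a variable
`j` receives the value `x j` if the array shows `0` at the colour of `j`, and otherwise a random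
letter whose law is chosen so as to make `Y j` uniform over `q` letters when the array entry is
uniform over `Q` letters; such a law exists because `q ≤ Q`. The zero functional yields `Y = x`.
-/

open Finset

/-! ### Orthogonal arrays -/

open scoped Classical in
/-- `u`, viewed as a table with rows `Ω`, columns `C` and entries in `K`, is an orthogonal array of
strength `k`: in at most `k` distinct columns, all patterns of entries occur in equally many
rows. -/
def IsOrthogonalArray {Ω C K : Type*} [Fintype Ω] [Fintype K] (u : Ω → C → K) (k : ℕ) : Prop :=
  ∀ a ≤ k, ∀ s : Fin a → C, Function.Injective s → ∀ z : Fin a → K,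
    #{ω | (fun i => u ω (s i)) = z} * Fintype.card K ^ a = Fintype.card Ω

/-- Distinct columns of an orthogonal array are independent and uniformly distributed. -/
theorem IsOrthogonalArray.sum_prod {Ω C K : Type*} [Fintype Ω] [Fintype K] [Nonempty K]
    {u : Ω → C → K} {k : ℕ} (hu : IsOrthogonalArray u k) {a : ℕ} (ha : a ≤ k) {s : Fin a → C}
    (hs : Function.Injective s) (g : Fin a → K → ℝ) :
    ∑ ω, ∏ i, g i (u ω (s i)) = Fintype.card Ω * ∏ i, ((∑ b, g i b) / Fintype.card K) := by
  classical
  have hK : (Fintype.card K : ℝ) ≠ 0 := by simp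
  have h1 : ∑ ω, ∏ i, g i (u ω (s i))
      = ∑ z : Fin a → K, (#{ω | (fun i => u ω (s i)) = z} : ℝ) * ∏ i, g i (z i) := by
    rw [← Finset.sum_fiberwise univ (fun ω => (fun i => u ω (s i)))]
    refine sum_congr rfl fun z _ => ?_
    rw [← nsmul_eq_mul]
    refine sum_eq_card_nsmul fun ω hω => ?_
    rw [mem_filter] at hω
    simp [← hω.2]
  have h2 (z : Fin a → K) : (#{ω | (fun i => u ω (s i)) = z} : ℝ)
      = Fintype.card Ω / (Fintype.card K : ℝ) ^ a := by
    rw [eq_div_iff (pow_ne_zero _ hK)]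
    have := hu a ha s hs z
    exact_mod_cast (by convert this)
  rw [h1]
  simp only [h2]
  rw [← mul_sum, prod_div_distrib, prod_univ_sum, Fintype.piFinset_univ]
  simp only [prod_const, card_univ, Fintype.card_fin]
  ring

/-- If any `k` of the vectors `h c` are linearly independent, then evaluating all linear functionals
at them gives an orthogonal array of strength `k`. -/
theorem isOrthogonalArray_dual {K V C : Type*} [Field K] [Fintype K] [AddCommGroup V] [Module K V]
    [Fintype (Module.Dual K V)] (h : C → V) (k : ℕ)
    (hh : ∀ a ≤ k, ∀ s : Fin a → C, Function.Injective s →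
      LinearIndependent K (fun i => h (s i))) :
    IsOrthogonalArray (fun (φ : Module.Dual K V) c => φ (h c)) k := by
  classical
  intro a ha s hs z
  let Φ : Module.Dual K V →+ (Fin a → K) :=
    { toFun := fun φ i => φ (h (s i))
      map_zero' := by ext; simp
      map_add' := by intros; ext; simp }
  have hsurj : Function.Surjective Φ := by
    intro y
    have hinj := (hh a ha s hs).fintypeLinearCombination_injective
    obtain ⟨g, hg⟩ := (Fintype.linearCombination K fun i => h (s i)).exists_leftInverse_of_injective
      (LinearMap.ker_eq_bot.2 hinj)
    refine ⟨(Fintype.linearCombination K y) ∘ₗ g, ?_⟩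
    ext i
    have h1 := LinearMap.congr_fun hg (Pi.single i 1)
    simp only [LinearMap.comp_apply, Fintype.linearCombination_apply_single, one_smul,
      LinearMap.id_apply] at h1
    change Fintype.linearCombination K y (g (h (s i))) = y i
    rw [h1, Fintype.linearCombination_apply_single, one_smul]
  have hfib (y : Fin a → K) : #{φ | Φ φ = y} = #{φ | Φ φ = z} :=
    AddMonoidHom.card_fiber_eq_of_mem_range Φ (hsurj y) (hsurj z)
  have hsum := card_eq_sum_card_fiberwise (f := Φ) (s := univ) (t := univ) (fun _ _ => by simp)
  simp only [hfib, sum_const, card_univ, Fintype.card_pi, prod_const, Fintype.card_fin,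
    smul_eq_mul] at hsum
  rw [hsum, mul_comm]
  congr 2

/-- The exponents in `[0, k)` other than `0, Q, Q ^ 2, …`. -/
def bchExponents (Q k : ℕ) : Finset ℕ :=
  range k \ insert 0 ((range (Nat.clog Q k - 1)).image fun j => Q ^ (j + 1))

theorem card_bchExponents {Q k : ℕ} (hQ : 2 ≤ Q) (hk : 2 ≤ k) :
    #(bchExponents Q k) = k - Nat.clog Q k := by
  have hpos : 0 < Nat.clog Q k := Nat.clog_pos hQ hk
  rw [bchExponents, card_sdiff_of_subset, card_range, card_insert_of_notMem, card_image_of_injective,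
    card_range]
  · omega
  · intro i j hij
    have := Nat.pow_right_injective hQ hij
    omega
  · simp only [mem_image, not_exists, not_and]
    intro j _ h0
    exact absurd h0 (by positivity)
  · intro i hi
    simp only [mem_insert, mem_image, mem_range] at hi ⊢
    obtain rfl | ⟨j, hj, rfl⟩ := hi
    · omega
    · exact (Nat.lt_clog_iff_pow_lt hQ).1 (by omega)

/-- The vector `(1, (x ^ i)_i)`, with `i` ranging over the exponents that are kept. -/
def bchVector (K : Type*) {F : Type*} [Field K] [Field F] (Q k : ℕ) (x : F) :
    K × (bchExponents Q k → F) :=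
  (1, fun i => x ^ (i : ℕ))

theorem linearIndependent_bchVector {K F : Type*} [Field K] [Fintype K] [Field F] [Algebra K F]
    {k : ℕ} (hk : 2 ≤ k) {a : ℕ} (ha : a ≤ k) {s : Fin a → F} (hs : Function.Injective s) :
    LinearIndependent K (fun i => bchVector K (Fintype.card K) k (s i)) := by
  rw [Fintype.linearIndependent_iff]
  intro c hc
  have hQ : 2 ≤ Fintype.card K := Fintype.one_lt_card
  have h0 : ∑ i, c i = 0 := by
    have := congrArg Prod.fst hc
    simpa [bchVector, Prod.fst_sum] using this
  have hE (e : ℕ) (he : e ∈ bchExponents (Fintype.card K) k) :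
      ∑ i, algebraMap K F (c i) * s i ^ e = 0 := by
    have := congrFun (congrArg Prod.snd hc) ⟨e, he⟩
    simpa [bchVector, Prod.snd_sum, Algebra.smul_def] using this
  -- The Frobenius endomorphism over `K` fixes the coefficients of a relation.
  have hfrob (j : ℕ) : ∑ i, algebraMap K F (c i) * s i ^ (Fintype.card K ^ j) = 0 := by
    induction j with
    | zero =>
      refine hE _ ?_
      simp only [bchExponents, mem_sdiff, mem_range, mem_insert, mem_image, pow_zero, not_or,
        not_exists, not_and]
      refine ⟨by omega, by omega, fun j _ h => ?_⟩
      exact absurd h (Nat.one_lt_pow (by omega) (by omega)).ne'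
    | succ j ih =>
      have := congrArg (FiniteField.frobeniusAlgHom K F) ih
      simpa [map_sum, map_mul, FiniteField.coe_frobeniusAlgHom, ← pow_mul, ← pow_succ, mul_pow,
        ← map_pow, FiniteField.pow_card] using this
  have hall (e : Fin a) : ∑ i, algebraMap K F (c i) * s i ^ (e : ℕ) = 0 := by
    by_cases he : (e : ℕ) ∈ bchExponents (Fintype.card K) k
    · exact hE _ he
    · simp only [bchExponents, mem_sdiff, mem_range, not_and, not_not, mem_insert, mem_image] at he
      obtain h | ⟨j, -, h⟩ := he (by omega)
      · simp [h, ← map_sum, h0]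
      · rw [← h]; exact hfrob _
  have hz := Matrix.eq_zero_of_forall_pow_sum_mul_pow_eq_zero hs hall
  intro i
  simpa using congrFun hz i

theorem exists_isOrthogonalArray {Q : ℕ} (hQ : IsPrimePow Q) {k t : ℕ} (hk : 2 ≤ k) (ht : t ≠ 0) :
    ∃ (K F Ω : Type) (_ : Field K) (_ : Fintype K) (_ : Fintype F) (_ : Fintype Ω)
      (u : Ω → F → K), Fintype.card K = Q ∧ Fintype.card F = Q ^ t ∧
        Fintype.card Ω = Q ^ (1 + t * (k - Nat.clog Q k)) ∧
        IsOrthogonalArray u k ∧ ∃ ω, u ω = 0 := by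
  classical
  obtain ⟨p, m, hp, hm, rfl⟩ := hQ
  have : Fact p.Prime := ⟨hp.nat_prime⟩
  have : NeZero t := ⟨ht⟩
  let K := GaloisField p m
  let F := FiniteField.Extension K p t
  let _ : Fintype K := Fintype.ofFinite K
  let _ : Fintype F := Fintype.ofFinite F
  have hK : Fintype.card K = p ^ m := by
    rw [Fintype.card_eq_nat_card]; exact GaloisField.card p m hm.ne'
  have hF : Fintype.card F = (p ^ m) ^ t := by
    rw [Fintype.card_eq_nat_card, FiniteField.natCard_extension, ← Fintype.card_eq_nat_card, hK]
  let V := K × (bchExponents (p ^ m) k → F)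
  have : Finite (Module.Dual K V) := Module.finite_of_finite K
  let _ : Fintype (Module.Dual K V) := Fintype.ofFinite _
  refine ⟨K, F, Module.Dual K V, inferInstance, inferInstance, inferInstance, inferInstance,
    fun φ x => φ (bchVector K (p ^ m) k x), hK, hF, ?_, ?_, 0, ?_⟩
  · have hQ2 : 2 ≤ p ^ m := by rw [← hK]; exact Fintype.one_lt_card
    rw [Module.card_eq_pow_finrank (K := K), Subspace.dual_finrank_eq, Module.finrank_prod,
      Module.finrank_pi_fintype, hK]
    simp only [sum_const, card_univ, Fintype.card_coe, card_bchExponents hQ2 hk,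
      Module.finrank_self, smul_eq_mul]
    rw [show Module.finrank K F = t from FiniteField.finrank_extension K p t, mul_comm t]
  · refine isOrthogonalArray_dual _ k fun a ha s hs => ?_
    have := linearIndependent_bchVector (K := K) hk ha hs
    rwa [hK] at this
  · ext; simp

/-! ### Solutions with uniform marginals -/

/-- Independent coordinates `j` with laws `f j` show the pattern `z` at the positions `s` with the
product probability. -/
theorem sum_prod_mul_indicator {n q a : ℕ} (f : Fin n → Fin q → ℝ) (hf : ∀ j, ∑ b, f j b = 1)
    {s : Fin a → Fin n} (hs : Function.Injective s) (z : Fin a → Fin q) :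
    ∑ y : Fin n → Fin q, (∏ j, f j (y j)) * (if (fun i => y (s i)) = z then 1 else 0)
      = ∏ i, f (s i) (z i) := by
  have h1 (y : Fin n → Fin q) : (∏ j, f j (y j)) * (if (fun i => y (s i)) = z then 1 else 0)
      = ∏ j, (f j (y j) * if ∀ i, s i = j → y j = z i then 1 else 0) := by
    rw [prod_mul_distrib]
    congr 1
    rw [prod_ite_zero]
    simp only [mem_univ, true_imp_iff, prod_const_one]
    refine if_congr ?_ rfl rfl
    rw [funext_iff]
    exact ⟨fun h j i hij => hij ▸ h i, fun h i => h _ i rfl⟩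
  simp only [h1]
  rw [← Fintype.piFinset_univ,
    ← prod_univ_sum (fun _ => univ) fun j b => f j b * if ∀ i, s i = j → b = z i then 1 else 0]
  symm
  refine Fintype.prod_of_injective s hs _ _ (fun j hj => ?_) fun i => ?_
  · refine Eq.trans ?_ (hf j)
    refine sum_congr rfl fun b _ => ?_
    rw [if_pos, mul_one]
    rintro i rfl
    exact absurd ⟨i, rfl⟩ hj
  · simp [hs.eq_iff]

namespace CSPInstance

variable {q : ℕ}

theorem sum_mul_value (I : CSPInstance q) (μ : (Fin I.n → Fin q) → ℝ)
    (hμ : ∀ i z, ∑ y, μ y * (if (fun j => y (I.support i j)) = z then 1 else 0)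
      = (1 / (q : ℝ)) ^ I.arity i) :
    ∑ y, μ y * I.value y = ∑ i, I.w i * ∑ z, I.P i z * (1 / (q : ℝ)) ^ I.arity i := by
  simp only [value, mul_sum]
  rw [sum_comm]
  refine sum_congr rfl fun i _ => ?_
  have h (z) : I.w i * (I.P i z * (1 / (q : ℝ)) ^ I.arity i) = ∑ y, I.w i * (I.P i z *
      (μ y * (if (fun j => y (I.support i j)) = z then 1 else 0))) := by
    rw [← hμ i z, mul_sum, mul_sum]
  simp only [h]
  rw [sum_comm]
  refine sum_congr rfl fun y _ => ?_
  rw [sum_eq_single (fun j => y (I.support i j))]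
  · rw [if_pos rfl]; ring
  · intro z _ hz
    rw [if_neg hz.symm]; ring
  · simp

/-- A law of solutions with uniform marginals on the supports has the same mean value as the uniform
law. -/
theorem sum_mul_value_eq_avg (I : CSPInstance q) (hq : q ≠ 0) (μ : (Fin I.n → Fin q) → ℝ)
    (hμ : ∀ i z, ∑ y, μ y * (if (fun j => y (I.support i j)) = z then 1 else 0)
      = (1 / (q : ℝ)) ^ I.arity i) :
    ∑ y, μ y * I.value y = I.avg := by
  have hq' : (q : ℝ) ≠ 0 := by exact_mod_cast hq
  rw [sum_mul_value I μ hμ, avg, div_eq_inv_mul _ ((q : ℝ) ^ I.n), mul_sum,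
    ← sum_mul_value I (fun _ => ((q : ℝ) ^ I.n)⁻¹)]
  intro i z
  have := sum_prod_mul_indicator (fun _ _ => 1 / (q : ℝ)) (fun _ => by simp [hq'])
    (I.support i).injective z
  simpa using this

/-- If a law with uniform marginals on the supports gives an optimal solution the mass `r`, then the
average differential ratio is at least `r`. -/
theorem le_avgDifferentialRatio (I : CSPInstance q) (hq : q ≠ 0) (hne : I.opt ≠ I.wor) {r : ℝ}
    (h : ∀ x : Fin I.n → Fin q, ∃ μ : (Fin I.n → Fin q) → ℝ, (∀ y, 0 ≤ μ y) ∧ ∑ y, μ y = 1 ∧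
      r ≤ μ x ∧
      ∀ i z, ∑ y, μ y * (if (fun j => y (I.support i j)) = z then 1 else 0)
        = (1 / (q : ℝ)) ^ I.arity i) :
    r ≤ I.avgDifferentialRatio := by
  have : NeZero q := ⟨hq⟩
  have hsup (y) : I.value y ≤ ⨆ x, I.value x := le_ciSup (Set.finite_range _).bddAbove y
  have hinf (y) : ⨅ x, I.value x ≤ I.value y := ciInf_le (Set.finite_range _).bddBelow y
  obtain ⟨x₁, h₁⟩ := exists_eq_ciSup_of_finite (f := I.value)
  obtain ⟨x₂, h₂⟩ := exists_eq_ciInf_of_finite (f := I.value)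
  have hle : ⨅ x, I.value x ≤ ⨆ x, I.value x := (hinf x₁).trans (hsup x₁)
  rw [avgDifferentialRatio]
  have key (μ : (Fin I.n → Fin q) → ℝ) (hs : ∑ y, μ y = 1) (b : ℝ) :
      ∑ y, μ y * I.value y - b = ∑ y, μ y * (I.value y - b) := by
    simp only [mul_sub, sum_sub_distrib, ← sum_mul, hs, one_mul]
  cases hg : I.goal with
  | maximize =>
    simp only [opt, wor, hg] at hne ⊢
    obtain ⟨μ, hμ0, hμ1, hμx, hμ⟩ := h x₁
    rw [le_div_iff₀ (sub_pos.2 (lt_of_le_of_ne hle hne.symm)),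
      ← sum_mul_value_eq_avg I hq μ hμ, key μ hμ1]
    calc _ ≤ μ x₁ * (I.value x₁ - ⨅ x, I.value x) := by
          rw [h₁]; exact mul_le_mul_of_nonneg_right hμx (sub_nonneg.2 hle)
      _ ≤ _ := single_le_sum (f := fun y => μ y * (I.value y - ⨅ x, I.value x))
          (fun y _ => mul_nonneg (hμ0 y) (sub_nonneg.2 (hinf y))) (mem_univ x₁)
  | minimize =>
    simp only [opt, wor, hg] at hne ⊢
    obtain ⟨μ, hμ0, hμ1, hμx, hμ⟩ := h x₂
    rw [← neg_div_neg_eq, neg_sub, neg_sub,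
      le_div_iff₀ (sub_pos.2 (lt_of_le_of_ne hle hne)), ← neg_sub (I.avg),
      ← sum_mul_value_eq_avg I hq μ hμ, key μ hμ1, ← sum_neg_distrib]
    calc _ ≤ -(μ x₂ * (I.value x₂ - ⨆ x, I.value x)) := by
          rw [h₂, ← mul_neg, neg_sub]; exact mul_le_mul_of_nonneg_right hμx (sub_nonneg.2 hle)
      _ ≤ _ := single_le_sum (f := fun y => -(μ y * (I.value y - ⨆ x, I.value x)))
          (fun y _ => neg_nonneg.2 (mul_nonpos_of_nonneg_of_nonpos (hμ0 y)
            (sub_nonpos.2 (hsup y)))) (mem_univ x₂)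

end CSPInstance

/-! ### Reduction of the alphabet -/

open scoped Classical in
/-- The probability that the letter `b` of `{0, …, q-1}` is drawn when the array entry is `a`: the
entry `0` yields the letter `x`, and the other entries yield a random letter, distributed so that a
uniform entry yields a uniform letter. -/
noncomputable def noiseKernel {K : Type*} [Zero K] [Fintype K] {q : ℕ} (x : Fin q) (a : K)
    (b : Fin q) : ℝ :=
  if a = 0 then if b = x then 1 else 0
  else ((Fintype.card K : ℝ) / q - if b = x then 1 else 0) / ((Fintype.card K : ℝ) - 1)

theorem noiseKernel_nonneg {K : Type*} [Zero K] [Fintype K] {q : ℕ} (hq : q ≤ Fintype.card K)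
    (x : Fin q) (a : K) (b : Fin q) : 0 ≤ noiseKernel x a b := by
  have hq0 : 0 < q := x.pos
  have h1 : (1 : ℝ) ≤ (Fintype.card K : ℝ) / q := by
    rw [one_le_div (by exact_mod_cast hq0)]; exact_mod_cast hq
  have h2 : (1 : ℝ) ≤ Fintype.card K := by exact_mod_cast hq0.trans_le hq
  unfold noiseKernel
  split_ifs <;> first | positivity | exact div_nonneg (by linarith) (by linarith)

theorem sum_noiseKernel_right {K : Type*} [Zero K] [Fintype K] [Nontrivial K] {q : ℕ} (x : Fin q)
    (a : K) : ∑ b, noiseKernel x a b = 1 := by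
  have hq0 : (q : ℝ) ≠ 0 := by exact_mod_cast x.pos.ne'
  have h2 : (1 : ℝ) < Fintype.card K := by exact_mod_cast Fintype.one_lt_card
  unfold noiseKernel
  split_ifs
  · simp
  · rw [← sum_div, sum_sub_distrib]
    simp only [sum_const, card_univ, Fintype.card_fin, nsmul_eq_mul, sum_ite_eq', mem_univ, if_true]
    rw [mul_div_cancel₀ _ hq0, div_self (by linarith)]

theorem sum_noiseKernel_left {K : Type*} [Zero K] [Fintype K] [Nontrivial K] {q : ℕ} (x b : Fin q) :
    ∑ a : K, noiseKernel x a b = (Fintype.card K : ℝ) / q := by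
  classical
  have h2 : (1 : ℝ) < Fintype.card K := by exact_mod_cast Fintype.one_lt_card
  rw [← add_sum_erase _ _ (mem_univ (0 : K))]
  have h (a : K) (ha : a ∈ univ.erase (0 : K)) : noiseKernel x a b
      = ((Fintype.card K : ℝ) / q - if b = x then 1 else 0) / ((Fintype.card K : ℝ) - 1) := by
    rw [noiseKernel, if_neg (ne_of_mem_erase ha)]
  rw [sum_congr rfl h, sum_const, card_erase_of_mem (mem_univ _), card_univ, nsmul_eq_mul,
    Nat.cast_sub Fintype.card_pos, Nat.cast_one, mul_div_cancel₀ _ (by linarith), noiseKernel,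
    if_pos rfl]
  ring

/-- An orthogonal array with columns for the colours, with a zero row, gives the lower bound
`1 / (number of rows)` on the average differential ratio. -/
theorem CSPInstance.one_div_card_le_avgDifferentialRatio {q k : ℕ} (I : CSPInstance q) (hq0 : q ≠ 0)
    (hk : I.IsKCSP k) (hne : I.opt ≠ I.wor) {K C Ω : Type*} [Field K] [Fintype K] [Fintype Ω]
    (hq : q ≤ Fintype.card K) {u : Ω → C → K} (hu : IsOrthogonalArray u k) (hu0 : ∃ ω, u ω = 0)
    (col : Fin I.n → C) (hcol : ∀ i, Function.Injective fun j => col (I.support i j)) :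
    1 / (Fintype.card Ω : ℝ) ≤ I.avgDifferentialRatio := by
  obtain ⟨ω₀, hω₀⟩ := hu0
  have hΩ : (0 : ℝ) < Fintype.card Ω := by exact_mod_cast Fintype.card_pos_iff.2 ⟨ω₀⟩
  have hK : (Fintype.card K : ℝ) ≠ 0 := by simp
  have hq0' : (q : ℝ) ≠ 0 := by exact_mod_cast hq0
  refine I.le_avgDifferentialRatio hq0 hne fun x => ?_
  refine ⟨fun y => (∑ ω, ∏ j, noiseKernel (x j) (u ω (col j)) (y j)) / Fintype.card Ω,
    fun y => ?_, ?_, ?_, fun i z => ?_⟩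
  · exact div_nonneg (sum_nonneg fun ω _ => prod_nonneg fun j _ => noiseKernel_nonneg hq _ _ _)
      hΩ.le
  · rw [← sum_div, sum_comm]
    have h (ω : Ω) : ∑ y : Fin I.n → Fin q, ∏ j, noiseKernel (x j) (u ω (col j)) (y j) = 1 := by
      rw [← Fintype.piFinset_univ,
        ← prod_univ_sum (fun _ => univ) fun j b => noiseKernel (x j) (u ω (col j)) b]
      simp [sum_noiseKernel_right]
    simp [h, hΩ.ne']
  · refine div_le_div_of_nonneg_right ?_ hΩ.le
    have h : ∏ j, noiseKernel (x j) (u ω₀ (col j)) (x j) = 1 :=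
      prod_eq_one fun j _ => by simp [hω₀, noiseKernel]
    rw [← h]
    exact single_le_sum (f := fun ω => ∏ j, noiseKernel (x j) (u ω (col j)) (x j))
      (fun ω _ => prod_nonneg fun j _ => noiseKernel_nonneg hq _ _ _) (mem_univ ω₀)
  · simp only [div_mul_eq_mul_div, sum_mul]
    rw [← sum_div, sum_comm]
    have h (ω : Ω) := sum_prod_mul_indicator (fun j b => noiseKernel (x j) (u ω (col j)) b)
      (fun j => sum_noiseKernel_right _ _) (I.support i).injective z
    simp only [h]
    rw [hu.sum_prod (hk i) (hcol i) fun j a => noiseKernel (x (I.support i j)) a (z j)]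
    simp only [sum_noiseKernel_left, prod_const, card_univ, Fintype.card_fin]
    rw [mul_div_cancel_left₀ _ hΩ.ne', div_right_comm, div_self hK]

theorem CSPInstance.isPartite_strongChromaticNumber {q : ℕ} (I : CSPInstance q) :
    I.IsPartite I.strongChromaticNumber :=
  Nat.sInf_mem (s := {c | I.IsPartite c}) ⟨_, I.isPartite_n⟩

/-! ### The bounds -/

/-- Between `q` and `2 * (q - 1)` there is a power of two. -/
theorem exists_isPrimePow_between {q : ℕ} (hq : 2 ≤ q) :
    ∃ a, IsPrimePow a ∧ q ≤ a ∧ a ≤ 2 * (q - 1) := by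
  have hpos : 0 < Nat.clog 2 q := Nat.clog_pos one_lt_two hq
  refine ⟨2 ^ Nat.clog 2 q, Nat.prime_two.isPrimePow.pow hpos.ne', Nat.le_pow_clog one_lt_two q, ?_⟩
  have h := Nat.pow_pred_clog_lt_self one_lt_two hq
  have : 2 ^ Nat.clog 2 q = 2 * 2 ^ (Nat.clog 2 q).pred := by
    rw [← pow_succ', ← Nat.succ_eq_add_one, Nat.succ_pred_eq_of_pos hpos]
  omega

theorem pow_clog_le_mul {Q ν : ℕ} (hQ : 2 ≤ Q) (hν : 2 ≤ ν) : Q ^ Nat.clog Q ν ≤ Q * ν := by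
  have hpos : 0 < Nat.clog Q ν := Nat.clog_pos hQ hν
  have h := Nat.pow_pred_clog_lt_self hQ hν
  rw [← Nat.succ_pred_eq_of_pos hpos, pow_succ']
  exact Nat.mul_le_mul_left _ h.le

theorem mainTheorem5 (q k Q : ℕ) (hq : 3 ≤ q) (hk : 2 ≤ k)
    (hQ : IsLeast {a : ℕ | IsPrimePow a ∧ q ≤ a} Q) :
    (IsPrimePow q → Q = q) ∧ (¬ IsPrimePow q → Q ≤ 2 * (q - 1)) ∧
    (∀ I : CSPInstance q, I.IsKCSP k → k ≤ I.strongChromaticNumber → I.opt ≠ I.wor →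
      I.avgDifferentialRatio ≥
          1 / (Q : ℝ) * (1 / (Q : ℝ) ^
            (⌈Real.logb Q I.strongChromaticNumber⌉₊ * (k - ⌈Real.logb Q k⌉₊))) ∧
      1 / (Q : ℝ) * (1 / (Q : ℝ) ^
            (⌈Real.logb Q I.strongChromaticNumber⌉₊ * (k - ⌈Real.logb Q k⌉₊))) ≥
          1 / (Q : ℝ) *
            (1 / ((Q : ℝ) * (I.strongChromaticNumber : ℝ)) ^ (k - ⌈Real.logb Q k⌉₊))) ∧
    (∃ C : ℝ, 0 < C ∧
      ∀ I : CSPInstance q, I.IsKCSP k → k ≤ I.strongChromaticNumber → I.opt ≠ I.wor →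
        I.avgDifferentialRatio ≥ C * (1 / (I.n : ℝ) ^ (k - ⌈Real.logb Q k⌉₊))) := by
  have hQ2 : 2 ≤ Q := by have := hQ.1.2; omega
  have hQ0 : (0 : ℝ) < Q := by exact_mod_cast (by omega : 0 < Q)
  simp only [Real.natCeil_logb_natCast]
  have bound (I : CSPInstance q) (hI : I.IsKCSP k) (hν : k ≤ I.strongChromaticNumber)
      (hne : I.opt ≠ I.wor) : I.avgDifferentialRatio ≥ 1 / (Q : ℝ) * (1 / (Q : ℝ) ^
        (Nat.clog Q I.strongChromaticNumber * (k - Nat.clog Q k))) := by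
    obtain ⟨K, F, Ω, _, _, _, _, u, hK, hF, hΩ, hu, hu0⟩ := exists_isOrthogonalArray hQ.1.1 hk
      (Nat.clog_pos hQ2 (hk.trans hν)).ne'
    obtain ⟨col, hcol⟩ := I.isPartite_strongChromaticNumber
    have hcard : Fintype.card (Fin I.strongChromaticNumber) ≤ Fintype.card F := by
      rw [hF, Fintype.card_fin]; exact Nat.le_pow_clog hQ2 _
    obtain ⟨e⟩ := Function.Embedding.nonempty_of_card_le hcard
    have h := I.one_div_card_le_avgDifferentialRatio (by omega) hI hne (hK ▸ hQ.1.2) hu hu0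
      (fun j => e (col j)) fun i => e.injective.comp (hcol i)
    rw [hΩ] at h
    refine le_of_eq_of_le ?_ h
    rw [one_div_mul_one_div, pow_add, pow_one, Nat.cast_mul, Nat.cast_pow]
  have weaken (ν : ℕ) (hν : k ≤ ν) :
      1 / (Q : ℝ) * (1 / (Q : ℝ) ^ (Nat.clog Q ν * (k - Nat.clog Q k))) ≥
        1 / (Q : ℝ) * (1 / ((Q : ℝ) * ν) ^ (k - Nat.clog Q k)) := by
    refine mul_le_mul_of_nonneg_left ?_ (by positivity)
    refine one_div_le_one_div_of_le (by positivity) ?_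
    rw [pow_mul]
    exact pow_le_pow_left₀ (by positivity) (by exact_mod_cast pow_clog_le_mul hQ2 (hk.trans hν)) _
  refine ⟨fun h => le_antisymm (hQ.2 ⟨h, le_rfl⟩) hQ.1.2, fun _ => ?_, fun I hI hν hne =>
    ⟨bound I hI hν hne, weaken _ hν⟩,
    1 / (Q : ℝ) * (1 / (Q : ℝ) ^ (k - Nat.clog Q k)), by positivity, fun I hI hν hne => ?_⟩
  · obtain ⟨a, ha, hqa, hle⟩ := exists_isPrimePow_between (q := q) (by omega)
    exact (hQ.2 ⟨ha, hqa⟩).trans hle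
  · refine le_trans ?_ ((weaken _ hν).le.trans (bound I hI hν hne))
    have hνn : I.strongChromaticNumber ≤ I.n := Nat.sInf_le I.isPartite_n
    have hν0 : 0 < I.strongChromaticNumber := by omega
    rw [mul_assoc, one_div_mul_one_div, ← mul_pow]
    gcongr
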